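/- Let $n,k\ge 1$ be integers and let $L\subseteq\{0,1,\dots,k-1\}$. A family $\mathcal F$ of $k$-element subsets of $[n]=\{1,\dots,n\}$ is called an $(n,k,L)$-system if $|F\cap F'|\in L$ for all distinct $F,F'\in\mathcal F$. Theorem. Let $t,k,n$ be integers with $2\le t\le \frac{k}{2}+1$ and $$(t+1)(k-t+1)\le n\le k^2+k(3-2t)+(t-1)^2 .$$ If $\mathcal F\subset\binom{[n]}{k}$ is an $(n,k,\{t-2\}\cup\{t,\dots,k-1\})$-system, then $$|\mathcal F|\le\binom{n-t}{k-t}.$$ -/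

import Mathlib

/-- `F` is an `(n, k, L)`-system: a family of `k`-element subsets of an `n`-element ground set
(here `Fin n`) such that any two distinct members have intersection size in `L`.
It is used for sets `L` of integers contained in `{0, …, k - 1}`. -/
def IsLSystem (n k : ℕ) (L : Set ℕ) (F : Finset (Finset (Fin n))) : Prop :=
  (∀ A ∈ F, A.card = k) ∧ ∀ A ∈ F, ∀ B ∈ F, A ≠ B → (A ∩ B).card ∈ L

/-!
The proof is the linear programming bound for the Johnson scheme with Wilson's matrix from his proof
of the exact Erdős–Ko–Rado theorem. Write `k = t + q` and `n = m + k`. For `k`-sets `S`, `T` let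
`Ω S T` be a suitable combination, over `i < t`, of the numbers of `(k - i)`-sets contained in `T` and
disjoint from `S` (`wilsonMatrix`). It depends only on `x = |S ∩ T|` and vanishes for `x ≥ t`. At
`x = t - 2` only two summands survive, and their sum is nonpositive exactly when `m ≤ (q + 1) ^ 2`,
which is the assumed upper bound on `n` (`wilsonMatrix_apply_nonpos`). If `I + Ω - J / C` with
`C = (n - t).choose (k - t)` is positive semidefinite, then evaluating its quadratic form at the
indicator of the family `F` gives `0 ≤ |F| - |F| ^ 2 / C` (`card_le_of_ratioMatrix_posSemidef`).

For positive semidefiniteness, filter the functions on `k`-sets by degree: `layer e` is spanned by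
the indicators of `E ⊆ S` with `|E| < e`. Every matrix in question is triangular for this
filtration, so its eigenvalues are among the scalars by which it acts on the successive quotients
(`eigenvalue_of_triangular`); no orthogonal decomposition is needed.

The scalar `θ e` of `Ω` on the quotient of degree `e` is an alternating sum of binomial coefficients.
Interpolation gives `θ 0 = C⁻¹ * n.choose k - 1`, which cancels the contribution of `J`. For `e ≥ 1`,
Vandermonde's identity turns `θ e` into a sum of plain finite differences. These give `θ e = -1` for
`1 ≤ e ≤ t`, and for `e = t + N + 1` they give `θ e = (-1) ^ N * wilsonAbs N`, where `wilsonAbs N` is a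
sum of positive terms (`wilsonEigenvalue_of_gt`). It decreases in `N ≥ 1` term by term
(`wilsonAbs_succ_le`), and `wilsonAbs 1 ≤ 1` follows from a telescoping sum (`wilsonAbs_one_le`), with
equality at the lower end `n = (t + 1) * (k - t + 1)` of the range. Hence `θ e ≥ -1` throughout.
-/

/-! ### Alternating binomial sums -/

/-- Pascal's rule for alternating sums: the `(p + 1)`-st alternating difference is the difference of
two shifted `p`-th ones. -/
lemma alternating_choose_sum_succ (p : ℕ) (f : ℕ → ℝ) :
    ∑ i ∈ Finset.range (p + 2), (-1 : ℝ) ^ i * (p + 1).choose i * f i =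
      ∑ i ∈ Finset.range (p + 1), (-1 : ℝ) ^ i * p.choose i * f i -
        ∑ i ∈ Finset.range (p + 1), (-1 : ℝ) ^ i * p.choose i * f (i + 1) := by
  have h : ∑ i ∈ Finset.range (p + 1), (-1 : ℝ) ^ i * p.choose i * f i =
      ∑ i ∈ Finset.range (p + 2), (-1 : ℝ) ^ i * p.choose i * f i := by
    rw [Finset.sum_range_succ _ (p + 1)]
    simp
  rw [h, Finset.sum_range_succ', Finset.sum_range_succ' _ (p + 1), add_sub_right_comm,
    ← Finset.sum_sub_distrib]
  congr 1
  · refine Finset.sum_congr rfl fun i _ => ?_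
    rw [Nat.choose_succ_succ]
    push_cast
    ring
  · simp

lemma alternating_sum_choose_add (a M p : ℕ) :
    ∑ i ∈ Finset.range (a + 1), (-1 : ℝ) ^ i * a.choose i * ((M + i).choose p : ℝ) =
      if p < a then 0 else (-1 : ℝ) ^ a * M.choose (p - a) := by
  induction a generalizing M with
  | zero => simp
  | succ a ih =>
    rw [alternating_choose_sum_succ, ih]
    have h := ih (M + 1)
    simp only [add_assoc, add_comm 1] at h
    rw [h]
    rcases lt_trichotomy p a with hp | rfl | hp
    · simp [hp, hp.trans (Nat.lt_succ_self a)]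
    · simp
    · obtain ⟨b, rfl⟩ : ∃ b, p = a + 1 + b := ⟨p - (a + 1), by omega⟩
      rw [if_neg (by omega), if_neg (by omega), if_neg (by omega), Nat.add_sub_cancel_left,
        show a + 1 + b - a = b + 1 by omega, Nat.choose_succ_succ]
      push_cast
      ring

lemma alternating_sum_factorial_div (p x N : ℕ) :
    ∑ i ∈ Finset.range (p + 1), (-1 : ℝ) ^ i * p.choose i *
        ((x + i).factorial / (x + i + N + 1).factorial : ℝ) =
      (N + p).factorial / N.factorial * (x.factorial / (x + N + 1 + p).factorial : ℝ) := by
  induction p generalizing x with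
  | zero =>
    have := Nat.factorial_ne_zero N
    simp
    field_simp
  | succ p ih =>
    rw [alternating_choose_sum_succ, ih]
    have h := ih (x + 1)
    simp only [add_assoc, add_comm, add_left_comm] at h ⊢
    rw [h]
    rw [show N + (p + (x + (1 + 1))) = (N + x + p + 1) + 1 by ring,
      show N + (p + (x + 1)) = N + x + p + 1 by ring,
      show N + (p + 1) = N + p + 1 by ring]
    simp only [Nat.factorial_succ]
    push_cast
    have := Nat.factorial_ne_zero N
    have := Nat.factorial_ne_zero (N + x + p)
    field_simp
    ring

lemma alternating_sum_choose_mul_choose (i a q : ℕ) :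
    ∑ j ∈ Finset.range (i + 1 + a),
        (-1 : ℝ) ^ j * (i + 1 + a + q).choose j * (j.choose i : ℝ) =
      (-1) ^ (i + a) * (i + 1 + a + q).choose i * ((a + q).choose q : ℝ) := by
  induction a generalizing q with
  | zero =>
    rw [add_zero, Finset.sum_range_succ, Finset.sum_eq_zero]
    · simp
    · intro j hj
      simp [Nat.choose_eq_zero_of_lt (Finset.mem_range.1 hj)]
  | succ a ih =>
    rw [← add_assoc, Finset.sum_range_succ]
    have h := ih (q + 1)
    rw [show i + 1 + a + (q + 1) = i + 1 + a + 1 + q by ring] at h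
    rw [h]
    have h1 := Nat.choose_mul (n := i + 1 + a + 1 + q) (show i ≤ i + 1 + a by omega)
    rw [show i + 1 + a + 1 + q - i = a + q + 1 + 1 by omega,
      show i + 1 + a - i = a + 1 by omega] at h1
    have h2 : (a + q + 1 + 1).choose (a + 1) = (a + q + 1 + 1).choose (q + 1) :=
      Nat.choose_symm_of_eq_add (by ring)
    rw [h2, Nat.choose_succ_succ] at h1
    have h1' := congrArg (Nat.cast : ℕ → ℝ) h1
    push_cast at h1'
    rw [mul_assoc ((-1 : ℝ) ^ (i + 1 + a)), h1', show a + (q + 1) = a + q + 1 by ring,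
      show a + 1 + q = a + q + 1 by ring]
    ring

/-- Vandermonde's identity reduces an alternating sum weighted by `(d + v - i).choose q` to plain
alternating sums of lower order. -/
lemma alternating_sum_vandermonde (d v q : ℕ) (R : ℕ → ℝ) :
    ∑ i ∈ Finset.range (d + 1), (-1 : ℝ) ^ i * (d + v - i).choose q * d.choose i * R i =
      ∑ b ∈ Finset.range (q + 1), (v.choose (q - b) : ℝ) * d.choose b *
        ∑ i ∈ Finset.range (d - b + 1), (-1 : ℝ) ^ i * (d - b).choose i * R i := by
  have h1 : ∀ i ∈ Finset.range (d + 1),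
      (-1 : ℝ) ^ i * (d + v - i).choose q * d.choose i * R i =
        ∑ b ∈ Finset.range (q + 1), (v.choose (q - b) : ℝ) * d.choose b *
          ((-1 : ℝ) ^ i * (d - b).choose i * R i) := by
    intro i hi
    have hi' : i ≤ d := Nat.lt_succ_iff.1 (Finset.mem_range.1 hi)
    rw [show d + v - i = (d - i) + v by omega, Nat.add_choose_eq,
      Finset.Nat.sum_antidiagonal_eq_sum_range_succ_mk]
    push_cast
    rw [Finset.mul_sum, Finset.sum_mul, Finset.sum_mul]
    refine Finset.sum_congr rfl fun b _ => ?_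
    have h : d.choose i * (d - i).choose b = d.choose b * (d - b).choose i := by
      have e1 := Nat.choose_mul (n := d) (show i ≤ i + b by omega)
      have e2 := Nat.choose_mul (n := d) (show b ≤ i + b by omega)
      rw [Nat.add_sub_cancel_left] at e1
      rw [Nat.add_sub_cancel] at e2
      rw [← e1, ← e2, Nat.choose_symm_add]
    have h' := congrArg (Nat.cast : ℕ → ℝ) h
    push_cast at h'
    linear_combination ((-1 : ℝ) ^ i * v.choose (q - b) * R i) * h'
  rw [Finset.sum_congr rfl h1, Finset.sum_comm]
  refine Finset.sum_congr rfl fun b _ => ?_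
  rw [← Finset.mul_sum]
  congr 1
  symm
  refine Finset.sum_subset (Finset.range_subset_range.2 (by omega)) fun i _ hi => ?_
  rw [Nat.choose_eq_zero_of_lt (by simpa using hi)]
  simp

/-- Lagrange interpolation of `x ↦ (M + x).choose t` at the nodes `0, …, t - 1`, evaluated at
`t + q`. -/
lemma sum_choose_interpolation (t q M : ℕ) :
    ∑ i ∈ Finset.range t, (-1 : ℝ) ^ (t + 1 + i) * (t + q - 1 - i).choose q *
        (t + q).choose i * ((M + i).choose t : ℝ) =
      (M + (t + q)).choose t - (t + q).choose t := by
  rw [add_comm M, Nat.add_choose_eq, Finset.Nat.sum_antidiagonal_eq_sum_range_succ_mk,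
    Finset.sum_range_succ]
  simp only [Nat.sub_self, Nat.choose_zero_right, mul_one, Nat.cast_add, add_sub_cancel_right]
  push_cast
  have h1 : ∀ j ∈ Finset.range t, ((t + q).choose j : ℝ) * M.choose (t - j) =
      ∑ i ∈ Finset.range t, (-1 : ℝ) ^ i * (M + i).choose t *
        ((-1) ^ j * (t + q).choose j * j.choose i) := by
    intro j hj
    have hj' := Finset.mem_range.1 hj
    have h := alternating_sum_choose_add j M t
    rw [if_neg (by omega), Finset.sum_subset (Finset.range_subset_range.2
      (show j + 1 ≤ t by omega))] at h
    · have hs : ((-1 : ℝ) ^ j) * (-1) ^ j = 1 := by rw [← mul_pow]; simp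
      calc _ = ((t + q).choose j : ℝ) * (-1) ^ j * ((-1) ^ j * M.choose (t - j)) := by
            linear_combination -((t + q).choose j : ℝ) * M.choose (t - j) * hs
        _ = _ := by
            rw [← h, Finset.mul_sum]
            refine Finset.sum_congr rfl fun i _ => ?_
            ring
    · intro i _ hi
      rw [Nat.choose_eq_zero_of_lt (by simpa using hi)]
      simp
  rw [Finset.sum_congr rfl h1, Finset.sum_comm]
  refine Finset.sum_congr rfl fun i hi => ?_
  obtain ⟨a, rfl⟩ : ∃ a, t = i + 1 + a :=
    ⟨t - (i + 1), by have := Finset.mem_range.1 hi; omega⟩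
  rw [← Finset.mul_sum, alternating_sum_choose_mul_choose,
    show i + 1 + a + q - 1 - i = a + q by omega]
  ring

/-! ### Wilson's eigenvalues -/

/-- The coefficients in Wilson's combination of disjointness matrices, for `k = t + q` and
`m = n - k`. -/
noncomputable def wilsonCoeff (m t q i : ℕ) : ℝ :=
  (-1) ^ (t + 1 + i) * (t + q - 1 - i).choose q / (m - t + i).choose q

/-- The eigenvalue of Wilson's matrix on the `e`-th layer of the Johnson scheme. -/
noncomputable def wilsonEigenvalue (m t q e : ℕ) : ℝ :=
  ∑ i ∈ Finset.range t, wilsonCoeff m t q i *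
    ((-1) ^ e * (m + i - e).choose (t + q - e) * (t + q - e).choose i)

lemma choose_div_choose_eq (M u q : ℕ) (h : u + q ≤ M) :
    ((M.choose (u + q) : ℝ) / (M - u).choose q) = M.choose u / (u + q).choose u := by
  have h1 := Nat.choose_mul (n := M) (show u ≤ u + q by omega)
  rw [Nat.add_sub_cancel_left] at h1
  have h1' := congrArg (Nat.cast : ℕ → ℝ) h1
  push_cast at h1'
  have : ((M - u).choose q : ℝ) ≠ 0 := by
    exact_mod_cast (Nat.choose_pos (by omega)).ne'
  have : ((u + q).choose u : ℝ) ≠ 0 := by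
    exact_mod_cast (Nat.choose_pos (by omega)).ne'
  field_simp
  linarith

lemma wilsonEigenvalue_zero (m t q : ℕ) (hm : t + q ≤ m) :
    wilsonEigenvalue m t q 0 = (m + (t + q)).choose t / (t + q).choose t - 1 := by
  have h0 : ((t + q).choose t : ℝ) ≠ 0 := by
    exact_mod_cast (Nat.choose_pos (by omega)).ne'
  have h := sum_choose_interpolation t q m
  rw [div_sub_one h0, ← h, Finset.sum_div]
  refine Finset.sum_congr rfl fun i _ => ?_
  have hr := choose_div_choose_eq (m + i) t q (by omega)
  rw [show m + i - t = m - t + i by omega] at hr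
  simp only [wilsonCoeff, Nat.sub_zero, pow_zero, one_mul]
  linear_combination ((-1 : ℝ) ^ (t + 1 + i) * (t + q - 1 - i).choose q * (t + q).choose i) * hr

/-- For `e = v + 1 ≥ 1` and `d = k - e`, the range of summation in the eigenvalue may be taken as
`0, …, d`, because the summands with `t ≤ i ≤ k - 1` vanish. -/
lemma wilsonEigenvalue_eq_alternating_sum (m t q d v : ℕ) (hq : 1 ≤ q) (h : d + v + 1 = t + q) :
    wilsonEigenvalue m t q (v + 1) = (-1) ^ (t + v) *
      ∑ i ∈ Finset.range (d + 1), (-1 : ℝ) ^ i * (d + v - i).choose q * d.choose i *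
        ((m + i - (v + 1)).choose d / (m - t + i).choose q : ℝ) := by
  set f : ℕ → ℝ := fun i => (-1 : ℝ) ^ i * (d + v - i).choose q * d.choose i *
        ((m + i - (v + 1)).choose d / (m - t + i).choose q : ℝ) with hf
  have e1 : ∑ i ∈ Finset.range (d + 1), f i = ∑ i ∈ Finset.range (t + d + 1), f i := by
    refine Finset.sum_subset (Finset.range_subset_range.2 (by omega)) fun i _ hi => ?_
    simp only [hf]
    rw [Nat.choose_eq_zero_of_lt (show d < i by simpa using hi)]
    simp
  have e2 : ∑ i ∈ Finset.range t, f i = ∑ i ∈ Finset.range (t + d + 1), f i := by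
    refine Finset.sum_subset (Finset.range_subset_range.2 (by omega)) fun i _ hi => ?_
    have hi' : t ≤ i := by simpa using hi
    simp only [hf]
    rw [Nat.choose_eq_zero_of_lt (show d + v - i < q by omega)]
    simp
  rw [e1, ← e2, Finset.mul_sum, wilsonEigenvalue]
  refine Finset.sum_congr rfl fun i _ => ?_
  simp only [hf, wilsonCoeff]
  rw [show t + q - 1 - i = d + v - i by omega, show t + q - (v + 1) = d by omega]
  ring

lemma wilsonEigenvalue_of_le (m t q e : ℕ) (hq : 1 ≤ q) (hm : t + q ≤ m) (he : 1 ≤ e)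
    (het : e ≤ t) : wilsonEigenvalue m t q e = -1 := by
  obtain ⟨v, rfl⟩ : ∃ v, e = v + 1 := ⟨e - 1, by omega⟩
  obtain ⟨u, rfl⟩ : ∃ u, t = u + (v + 1) := ⟨t - (v + 1), by omega⟩
  rw [wilsonEigenvalue_eq_alternating_sum m _ q (u + q) v hq (by ring)]
  have hu : ((u + q).choose u : ℝ) ≠ 0 := by
    exact_mod_cast (Nat.choose_pos (by omega)).ne'
  have hR : ∀ i ∈ Finset.range (u + q + 1),
      (-1 : ℝ) ^ i * (u + q + v - i).choose q * (u + q).choose i *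
        ((m + i - (v + 1)).choose (u + q) / (m - (u + (v + 1)) + i).choose q : ℝ) =
      (-1 : ℝ) ^ i * (u + q + v - i).choose q * (u + q).choose i *
        ((m - (v + 1) + i).choose u / (u + q).choose u : ℝ) := by
    intro i _
    rw [← choose_div_choose_eq _ u q (by omega), show m + i - (v + 1) = m - (v + 1) + i by omega,
      show m - (v + 1) + i - u = m - (u + (v + 1)) + i by omega]
  rw [Finset.sum_congr rfl hR, alternating_sum_vandermonde, Finset.sum_range_succ,
    Finset.sum_eq_zero]
  · simp only [← mul_div_assoc, ← Finset.sum_div]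
    rw [alternating_sum_choose_add, Nat.add_sub_cancel, if_neg (lt_irrefl _)]
    rw [Nat.choose_symm_add] at hu ⊢
    simp only [Nat.sub_self, Nat.choose_zero_right, Nat.cast_one, one_mul, mul_one, zero_add]
    rw [mul_div_cancel_left₀ _ hu, ← pow_add, Odd.neg_one_pow ⟨u + v, by ring⟩]
  · intro b hb
    have hb' := Finset.mem_range.1 hb
    simp only [← mul_div_assoc, ← Finset.sum_div]
    rw [alternating_sum_choose_add, if_pos (by omega)]
    simp

/-- The absolute value of Wilson's eigenvalue on layer `t + N + 1`. -/
noncomputable def wilsonAbs (m t q N : ℕ) : ℝ :=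
  ∑ a ∈ Finset.range q, ((t + N).choose (N + 1 + a) : ℝ) * q.choose (N + 1 + a) *
    (N + a).choose N / (m - t + a).choose (N + 1 + a)

/-- On the layers above `t` the alternating sum defining the eigenvalue becomes a sum of terms of
constant sign. -/
lemma wilsonEigenvalue_of_gt (m t d N : ℕ) (hm : t + (d + N + 1) ≤ m) :
    wilsonEigenvalue m t (d + N + 1) (t + N + 1) = (-1) ^ N * wilsonAbs m t (d + N + 1) N := by
  rw [wilsonEigenvalue_eq_alternating_sum m t _ d (t + N) (by omega) (by ring)]
  obtain ⟨x, rfl⟩ : ∃ x, m = x + (t + N + 1) := ⟨m - (t + N + 1), by omega⟩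
  have hR : ∀ i ∈ Finset.range (d + 1),
      (-1 : ℝ) ^ i * (d + (t + N) - i).choose (d + N + 1) * d.choose i *
        ((x + (t + N + 1) + i - (t + N + 1)).choose d /
          (x + (t + N + 1) - t + i).choose (d + N + 1) : ℝ) =
      (-1 : ℝ) ^ i * (d + (t + N) - i).choose (d + N + 1) * d.choose i *
        ((d + N + 1).factorial / d.factorial *
          ((x + i).factorial / (x + i + N + 1).factorial : ℝ)) := by
    intro i _
    congr 1
    rw [show x + (t + N + 1) + i - (t + N + 1) = x + i by omega,
      show x + (t + N + 1) - t + i = x + i + N + 1 by omega,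
      Nat.cast_choose ℝ (show d ≤ x + i by omega),
      Nat.cast_choose ℝ (show d + N + 1 ≤ x + i + N + 1 by omega),
      show x + i + N + 1 - (d + N + 1) = x + i - d by omega]
    have := Nat.factorial_ne_zero d
    have := Nat.factorial_ne_zero (x + i)
    have := Nat.factorial_ne_zero (x + i - d)
    have := Nat.factorial_ne_zero (x + i + N + 1)
    have := Nat.factorial_ne_zero (d + N + 1)
    field_simp
  rw [Finset.sum_congr rfl hR, alternating_sum_vandermonde, wilsonAbs, show (-1 : ℝ) ^ (t + (t + N))
    = (-1) ^ N by rw [← add_assoc, pow_add, Even.neg_one_pow ⟨t, rfl⟩, one_mul]]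
  congr 1
  rw [← Finset.sum_subset (Finset.range_subset_range.2 (show d + 1 ≤ d + N + 1 + 1 by omega)),
    ← Finset.sum_subset (Finset.range_subset_range.2 (show d + 1 ≤ d + N + 1 by omega)),
    ← Finset.sum_range_reflect]
  · refine Finset.sum_congr rfl fun a ha => ?_
    have ha' := Finset.mem_range.1 ha
    obtain ⟨b, rfl⟩ : ∃ b, d = a + b := ⟨d - a, by omega⟩
    simp only [mul_left_comm _ ((a + b + N + 1).factorial / (a + b).factorial : ℝ)]
    rw [← Finset.mul_sum, show a + b + 1 - 1 - a = b by omega, show a + b - b = a by omega,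
      alternating_sum_factorial_div,
      show a + b + N + 1 - b = N + 1 + a by omega,
      show x + (t + N + 1) - t + a = x + N + 1 + a by omega,
      Nat.cast_choose ℝ (show b ≤ a + b by omega),
      Nat.cast_choose ℝ (show N + 1 + a ≤ a + b + N + 1 by omega),
      Nat.cast_choose ℝ (show N ≤ N + a by omega),
      Nat.cast_choose ℝ (show N + 1 + a ≤ x + N + 1 + a by omega),
      show a + b - b = a by omega, show a + b + N + 1 - (N + 1 + a) = b by omega,
      show N + a - N = a by omega, show x + N + 1 + a - (N + 1 + a) = x by omega]
    have := Nat.factorial_ne_zero a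
    have := Nat.factorial_ne_zero b
    have := Nat.factorial_ne_zero (a + b)
    have := Nat.factorial_ne_zero N
    have := Nat.factorial_ne_zero (N + a)
    have := Nat.factorial_ne_zero x
    have := Nat.factorial_ne_zero (N + 1 + a)
    have := Nat.factorial_ne_zero (x + N + 1 + a)
    have := Nat.factorial_ne_zero (a + b + N + 1)
    field_simp
  · intro a _ ha
    have ha' : d + 1 ≤ a := by simpa using ha
    rw [Nat.choose_eq_zero_of_lt (show d + N + 1 < N + 1 + a by omega)]
    simp
  · intro b _ hb
    have hb' : d + 1 ≤ b := by simpa using hb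
    rw [Nat.choose_eq_zero_of_lt (show d < b by omega)]
    simp

lemma wilsonAbs_nonneg (m t q N : ℕ) : 0 ≤ wilsonAbs m t q N :=
  Finset.sum_nonneg fun _ _ => by positivity

/-- The comparison holds term by term. It can fail for `N = 0`, but on layer `t + 1` the eigenvalue is
nonnegative anyway. -/
lemma wilsonAbs_succ_le (m t q N : ℕ) (ht : 2 ≤ t) (hN : 1 ≤ N) (hq : N + 1 ≤ q)
    (hm : t * q + 1 ≤ m) : wilsonAbs m t q (N + 1) ≤ wilsonAbs m t q N := by
  have hmt : t + q ≤ m := by nlinarith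
  refine Finset.sum_le_sum fun a _ => ?_
  rcases Nat.lt_or_ge q (N + 1 + 1 + a) with h | h
  · rw [Nat.choose_eq_zero_of_lt h]
    simp only [Nat.cast_zero, mul_zero, zero_mul, zero_div]
    positivity
  obtain ⟨b, rfl⟩ : ∃ b, q = N + 1 + a + 1 + b := ⟨q - (N + 1 + a + 1), by omega⟩
  obtain ⟨x, rfl⟩ : ∃ x, m = t + (x + N + 1 + 1) := ⟨m - t - (N + 1 + 1), by omega⟩
  rw [show t + (x + N + 1 + 1) - t + a = N + 1 + a + 1 + x by omega,
    show N + 1 + 1 + a = N + 1 + a + 1 by ring, show t + (N + 1) = t + N + 1 by ring,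
    show N + 1 + a = N + a + 1 by ring]
  -- Each of the four ratios of consecutive binomial coefficients is explicit.
  have h1 := Nat.add_one_mul_choose_eq (t + N) (N + a + 1)
  have h2 := Nat.choose_succ_right_eq (N + a + 1 + 1 + b) (N + a + 1)
  rw [show N + a + 1 + 1 + b - (N + a + 1) = b + 1 by omega] at h2
  have h3 := Nat.add_one_mul_choose_eq (N + a) N
  have h4 := Nat.choose_succ_right_eq (N + a + 1 + 1 + x) (N + a + 1)
  rw [show N + a + 1 + 1 + x - (N + a + 1) = x + 1 by omega] at h4
  have p4 : 0 < (N + a + 1 + 1 + x).choose (N + a + 1) := Nat.choose_pos (by omega)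
  have p4' : 0 < (N + a + 1 + 1 + x).choose (N + a + 1 + 1) := Nat.choose_pos (by omega)
  have key : (t + N + 1) * (b + 1) ≤ (N + 1) * (x + 1) := by
    have hx : t * (N + a + b + 1) ≤ x + N + 1 := by nlinarith
    have hx' := Nat.mul_le_mul_left (N + 1) hx
    have ht1 := Nat.mul_le_mul_right (N * (b + 1) + (N + 1) * N) ht
    have hb := Nat.mul_le_mul_right (b + 1) hN
    nlinarith [Nat.zero_le (t * ((N + 1) * a))]
  rw [div_le_div_iff₀ (by exact_mod_cast p4') (by exact_mod_cast p4)]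
  norm_cast
  refine le_of_mul_le_mul_left (a := (N + a + 1 + 1) * (N + a + 1 + 1) * (N + 1)) ?_
    (by positivity)
  generalize (t + N + 1).choose (N + a + 1 + 1) = c1' at *
  generalize (t + N).choose (N + a + 1) = c1 at *
  generalize (N + a + 1 + 1 + b).choose (N + a + 1 + 1) = c2' at *
  generalize (N + a + 1 + 1 + b).choose (N + a + 1) = c2 at *
  generalize (N + a + 1).choose (N + 1) = c3' at *
  generalize (N + a).choose N = c3 at *
  generalize (N + a + 1 + 1 + x).choose (N + a + 1 + 1) = c4' at *
  generalize (N + a + 1 + 1 + x).choose (N + a + 1) = c4 at *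
  calc _ = (c1' * (N + a + 1 + 1)) * (c2' * (N + a + 1 + 1)) * (c3' * (N + 1)) * c4 := by ring
    _ = (c1 * c2 * c3 * c4 * (N + a + 1)) * ((t + N + 1) * (b + 1)) := by
        rw [← h1, h2, ← h3]; ring
    _ ≤ (c1 * c2 * c3 * c4 * (N + a + 1 + 1)) * ((N + 1) * (x + 1)) := by
        exact Nat.mul_le_mul (Nat.mul_le_mul_left _ (Nat.le_succ _)) key
    _ = c1 * c2 * c3 * (c4 * (x + 1)) * (N + a + 1 + 1) * (N + 1) := by ring
    _ = _ := by rw [← h4]; ring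

/-- A telescoping sum. In the extremal case `y + 1 = t * (q - 1)` the linear factor is a multiple
of `1 - c`. -/
lemma sum_choose_mul_choose_div_telescope (t q y L : ℕ) :
    ∑ c ∈ Finset.range L, ((t + 1).choose c * q.choose c / (y + c).choose c : ℝ) *
        ((t + 1) * q - c * (t + q + y + 1)) =
      L * (y + L) * ((t + 1).choose L * q.choose L / (y + L).choose L) := by
  induction L with
  | zero => simp
  | succ L ih =>
    rw [Finset.sum_range_succ, ih]
    have cast_sub : ∀ n : ℕ, (n.choose (L + 1) : ℝ) * (L + 1) = n.choose L * (n - L) := by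
      intro n
      have h := congrArg (Nat.cast : ℕ → ℝ) (Nat.choose_succ_right_eq n L)
      push_cast at h
      rw [h]
      rcases le_or_gt L n with hL | hL
      · rw [Nat.cast_sub hL]
      · simp [Nat.choose_eq_zero_of_lt hL]
    have h1 := cast_sub (t + 1)
    have h2 := cast_sub q
    have h3 := congrArg (Nat.cast : ℕ → ℝ) (Nat.add_one_mul_choose_eq (y + L) L)
    push_cast at h1 h3 ⊢
    rw [← add_assoc y L 1]
    have p1 : ((y + L).choose L : ℝ) ≠ 0 := by
      exact_mod_cast (Nat.choose_pos (by omega)).ne'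
    have p2 : ((y + L + 1).choose (L + 1) : ℝ) ≠ 0 := by
      exact_mod_cast (Nat.choose_pos (by omega)).ne'
    have hL : (L + 1 : ℝ) ≠ 0 := by positivity
    have e : (L + 1 : ℝ) * (y + (L + 1)) *
        ((t + 1).choose (L + 1) * q.choose (L + 1) / (y + L + 1).choose (L + 1)) =
        ((t + 1).choose L * q.choose L / (y + L).choose L) * ((t + 1 - L) * (q - L)) := by
      rw [← mul_div_assoc, div_mul_eq_mul_div, div_eq_div_iff p2 p1]
      refine mul_left_cancel₀ hL ?_
      linear_combination ((y + (L + 1)) * (q.choose (L + 1) : ℝ) * (L + 1) * (y + L).choose L) * h1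
        + ((y + (L + 1)) * ((t + 1).choose L : ℝ) * (t + 1 - L) * (y + L).choose L) * h2
        + ((t + 1).choose L * (t + 1 - L) * q.choose L * (q - L) : ℝ) * h3
    rw [e]
    ring

/-- Equality holds for `m = t * q + 1`. This is the layer that forces the lower bound on the size of
the ground set. -/
lemma wilsonAbs_one_le (m t q : ℕ) (hq : 2 ≤ q) (hm : t * q + 1 ≤ m) (ht : 2 ≤ t) :
    wilsonAbs m t q 1 ≤ 1 := by
  have hmt : t + 2 ≤ m := by nlinarith
  obtain ⟨y, rfl⟩ : ∃ y, m = t + (y + 2) := ⟨m - t - 2, by omega⟩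
  set w : ℕ → ℝ := fun c => (t + 1).choose c * q.choose c / (y + c).choose c with hw
  have hw0 : ∀ c, 0 ≤ w c := fun c => by positivity
  have htel := sum_choose_mul_choose_div_telescope t q y (q + 2)
  rw [Nat.choose_eq_zero_of_lt (show q < q + 2 by omega)] at htel
  simp only [Nat.cast_zero, mul_zero, zero_div] at htel
  have hy : ((t : ℝ) + 1) * q ≤ t + q + y + 1 := by
    have : (t + 1) * q ≤ t + q + y + 1 := by nlinarith
    exact_mod_cast this
  have hpos : (0 : ℝ) < (t + 1) * q := by positivity
  have h1 : ∑ c ∈ Finset.range (q + 2), w c * ((c : ℝ) - 1) ≤ 0 := by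
    have h2 : ((t : ℝ) + 1) * q * ∑ c ∈ Finset.range (q + 2), w c * ((c : ℝ) - 1) ≤ 0 := by
      rw [← neg_nonneg, ← htel, ← sub_nonpos, sub_neg_eq_add, Finset.mul_sum,
        ← Finset.sum_add_distrib]
      refine Finset.sum_nonpos fun c _ => ?_
      have := mul_le_mul_of_nonneg_left hy (mul_nonneg (hw0 c) (Nat.cast_nonneg (α := ℝ) c))
      simp only [hw] at this ⊢
      linarith
    exact nonpos_of_mul_nonpos_right h2 hpos
  rw [Finset.sum_range_succ', Finset.sum_range_succ'] at h1
  have h3 : wilsonAbs (t + (y + 2)) t q 1 =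
      ∑ c ∈ Finset.range q, w (c + 1 + 1) * (((c + 1 + 1 : ℕ) : ℝ) - 1) := by
    refine Finset.sum_congr rfl fun a _ => ?_
    simp only [hw]
    rw [show 1 + 1 + a = a + 1 + 1 by ring, show t + (y + 2) - t + a = y + (a + 1 + 1) by omega,
      Nat.choose_one_right]
    push_cast
    ring
  rw [h3]
  simp [hw] at h1 ⊢
  linarith

lemma neg_one_le_wilsonEigenvalue (m t q e : ℕ) (ht : 2 ≤ t) (hq : 1 ≤ q) (hm : t * q + 1 ≤ m)
    (he : 1 ≤ e) (hek : e ≤ t + q) : -1 ≤ wilsonEigenvalue m t q e := by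
  have hmt : t + q ≤ m := by nlinarith
  rcases le_or_gt e t with het | het
  · exact (wilsonEigenvalue_of_le m t q e hq hmt he het).ge
  obtain ⟨N, rfl⟩ : ∃ N, e = t + N + 1 := ⟨e - t - 1, by omega⟩
  obtain ⟨d, rfl⟩ : ∃ d, q = d + N + 1 := ⟨q - N - 1, by omega⟩
  rw [wilsonEigenvalue_of_gt m t d N hmt]
  have h0 := wilsonAbs_nonneg m t (d + N + 1) N
  rcases Nat.even_or_odd N with hN | hN
  · rw [hN.neg_one_pow]
    linarith
  · rw [hN.neg_one_pow]
    have : ∀ M, 1 ≤ M → M ≤ N → wilsonAbs m t (d + N + 1) M ≤ 1 := by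
      intro M hM
      induction M, hM using Nat.le_induction with
      | base => exact fun _ => wilsonAbs_one_le m t _ (by have := hN.pos; omega) hm ht
      | succ M hM ih =>
        exact fun h => (wilsonAbs_succ_le m t _ M ht hM (by omega) hm).trans (ih (by omega))
    linarith [this N hN.pos le_rfl]

/-! ### Inclusion vectors and triangular operators -/

/-- The indicator, on `k`-sets `S`, of the condition `E ⊆ S`. -/
def inclVec {α : Type*} [DecidableEq α] (k : ℕ) (E : Finset α) :
    {S : Finset α // S.card = k} → ℝ :=
  fun S => if E ⊆ S.1 then 1 else 0

/-- The indicator, on `k`-sets `S`, of the condition that `E` and `S` are disjoint. -/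
def avoidVec {α : Type*} [DecidableEq α] (k : ℕ) (E : Finset α) :
    {S : Finset α // S.card = k} → ℝ :=
  fun S => if Disjoint E S.1 then 1 else 0

/-- The functions on `k`-sets of degree less than `e`: the span of the inclusion vectors of sets
with fewer than `e` elements. -/
def layer (α : Type*) [DecidableEq α] (k e : ℕ) :
    Submodule ℝ ({S : Finset α // S.card = k} → ℝ) :=
  Submodule.span ℝ {f | ∃ E : Finset α, E.card < e ∧ inclVec k E = f}

section Layers

variable {α : Type*} [DecidableEq α] {k : ℕ}

lemma inclVec_mem_layer {E : Finset α} {e : ℕ} (h : E.card < e) : inclVec k E ∈ layer α k e :=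
  Submodule.subset_span ⟨E, h, rfl⟩

lemma layer_mono {e f : ℕ} (h : e ≤ f) : layer α k e ≤ layer α k f :=
  Submodule.span_mono fun _ ⟨E, hE, hf⟩ => ⟨E, hE.trans_le h, hf⟩

lemma layer_zero : layer α k 0 = ⊥ := by
  simp [layer]

lemma layer_succ_eq_top [Fintype α] : layer α k (k + 1) = ⊤ := by
  rw [eq_top_iff]
  intro f _
  have hf : f = ∑ S : {S : Finset α // S.card = k}, f S • inclVec k S.1 := by
    ext T
    rw [Finset.sum_apply, Finset.sum_eq_single T]
    · simp [inclVec]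
    · intro S _ hST
      have : ¬ S.1 ⊆ T.1 := fun h =>
        hST (Subtype.ext (Finset.eq_of_subset_of_card_le h (by rw [S.2, T.2])))
      simp [inclVec, this]
    · simp
  rw [hf]
  exact Submodule.sum_mem _ fun S _ =>
    Submodule.smul_mem _ _ (inclVec_mem_layer (by rw [S.2]; exact Nat.lt_succ_self k))

/-- An operator that acts on each quotient `layer (e + 1) / layer e` as the scalar `μ e` has all its
eigenvalues among the `μ e`. -/
lemma eigenvalue_of_triangular [Fintype α]
    (T : ({S : Finset α // S.card = k} → ℝ) →ₗ[ℝ] ({S : Finset α // S.card = k} → ℝ)) (μ : ℕ → ℝ)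
    (hT : ∀ E : Finset α, E.card ≤ k →
      T (inclVec k E) - μ E.card • inclVec k E ∈ layer α k E.card)
    {v : {S : Finset α // S.card = k} → ℝ} (hv : v ≠ 0) {c : ℝ} (hc : T v = c • v) :
    ∃ e ≤ k, c = μ e := by
  classical
  have hex : ∃ e, v ∈ layer α k e := ⟨k + 1, by rw [layer_succ_eq_top]; trivial⟩
  obtain ⟨e, he⟩ : ∃ e, Nat.find hex = e + 1 := by
    refine Nat.exists_eq_succ_of_ne_zero fun h => hv ?_
    have := Nat.find_spec hex
    rwa [h, layer_zero, Submodule.mem_bot] at this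
  have hve : v ∈ layer α k (e + 1) := he ▸ Nat.find_spec hex
  have hvn : v ∉ layer α k e := Nat.find_min hex (by omega)
  have hek : e ≤ k := by
    have := Nat.find_min' hex (show v ∈ layer α k (k + 1) by rw [layer_succ_eq_top]; trivial)
    omega
  refine ⟨e, hek, ?_⟩
  have hstep : ∀ u ∈ layer α k (e + 1), T u - μ e • u ∈ layer α k e := by
    intro u hu
    induction hu using Submodule.span_induction with
    | mem u hu =>
      obtain ⟨E, hE, rfl⟩ := hu
      rcases (Nat.lt_succ_iff.1 hE).eq_or_lt with h | h
      · rw [← h]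
        exact hT E (h.trans_le hek)
      · have h1 := layer_mono h.le (hT E (h.le.trans hek))
        have h2 := inclVec_mem_layer (k := k) h
        have := (layer α k e).add_mem h1 ((layer α k e).smul_mem (μ E.card - μ e) h2)
        convert this using 1
        module
    | zero => simp
    | add x y _ _ hx hy =>
      have := (layer α k e).add_mem hx hy
      convert this using 1
      rw [map_add]
      module
    | smul a x _ hx =>
      have := (layer α k e).smul_mem a hx
      convert this using 1
      rw [map_smul]
      module
  by_contra hne
  have h := hstep v hve
  rw [hc, ← sub_smul] at h
  exact hvn (((layer α k e).smul_mem_iff (sub_ne_zero.2 hne)).1 h)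

lemma avoidVec_eq_sum (E : Finset α) :
    avoidVec k E = ∑ I ∈ E.powerset, (-1 : ℝ) ^ I.card • inclVec k I := by
  ext S
  rw [Finset.sum_apply]
  simp only [Pi.smul_apply, inclVec, smul_eq_mul, mul_ite, mul_one, mul_zero]
  rw [← Finset.sum_filter, show E.powerset.filter (· ⊆ S.1) = (E ∩ S.1).powerset by
    ext I; simp only [Finset.mem_filter, Finset.mem_powerset, Finset.subset_inter_iff]]
  have h := congrArg (Int.cast : ℤ → ℝ) (Finset.sum_powerset_neg_one_pow_card (x := E ∩ S.1))
  push_cast at h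
  rw [h]
  simp [avoidVec, Finset.disjoint_iff_inter_eq_empty]

lemma avoidVec_sub_mem_layer (E : Finset α) :
    avoidVec k E - (-1 : ℝ) ^ E.card • inclVec k E ∈ layer α k E.card := by
  rw [avoidVec_eq_sum, ← Finset.sum_erase_eq_sub (Finset.mem_powerset_self E)]
  refine Submodule.sum_mem _ fun I hI => Submodule.smul_mem _ _ (inclVec_mem_layer ?_)
  rw [Finset.mem_erase, Finset.mem_powerset] at hI
  exact Finset.card_lt_card (hI.2.ssubset_of_ne hI.1)

lemma avoidVec_mem_layer {E : Finset α} {e : ℕ} (h : E.card < e) : avoidVec k E ∈ layer α k e := by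
  have h1 := layer_mono h.le (avoidVec_sub_mem_layer (k := k) E)
  have := (layer α k e).add_mem h1
    ((layer α k e).smul_mem ((-1 : ℝ) ^ E.card) (inclVec_mem_layer h))
  simpa using this

end Layers

/-! ### Disjointness matrices -/

lemma card_filter_superset_powersetCard {α : Type*} [DecidableEq α] {A U : Finset α} {j : ℕ}
    (hA : A ⊆ U) (hj : j ≤ U.card) :
    ((U.powersetCard j).filter (A ⊆ ·)).card = (U.card - A.card).choose (U.card - j) := by
  rw [← Finset.card_sdiff_of_subset hA, ← Finset.card_powersetCard]
  refine Finset.card_nbij' (U \ ·) (U \ ·) ?_ ?_ ?_ ?_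
  · intro J hJ
    simp only [Finset.coe_filter, Finset.mem_powersetCard, Set.mem_ofPred_eq, Finset.mem_coe] at hJ ⊢
    exact ⟨Finset.sdiff_subset_sdiff le_rfl hJ.2, by
      rw [Finset.card_sdiff_of_subset hJ.1.1, hJ.1.2]⟩
  · intro J hJ
    simp only [Finset.coe_filter, Finset.mem_powersetCard, Set.mem_ofPred_eq, Finset.mem_coe] at hJ ⊢
    have hJU := hJ.1.trans Finset.sdiff_subset
    refine ⟨⟨Finset.sdiff_subset, ?_⟩, ?_⟩
    · rw [Finset.card_sdiff_of_subset hJU, hJ.2]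
      omega
    · intro x hx
      rw [Finset.mem_sdiff]
      exact ⟨hA hx, fun h => (Finset.mem_sdiff.1 (hJ.1 h)).2 hx⟩
  · intro J hJ
    simp only [Finset.coe_filter, Finset.mem_powersetCard, Set.mem_ofPred_eq] at hJ
    exact Finset.sdiff_sdiff_eq_self hJ.1.1
  · intro J hJ
    simp only [Finset.mem_powersetCard, Finset.mem_coe] at hJ
    exact Finset.sdiff_sdiff_eq_self (hJ.1.trans Finset.sdiff_subset)

lemma sum_superset_indicator {α : Type*} [DecidableEq α] [Fintype α] {k : ℕ}
    (hk : k ≤ Fintype.card α) (A : Finset α) :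
    ∑ T : {S : Finset α // S.card = k}, (if A ⊆ T.1 then (1 : ℝ) else 0) =
      ((Fintype.card α - A.card).choose (Fintype.card α - k) : ℝ) := by
  have h := card_filter_superset_powersetCard (j := k) (Finset.subset_univ A)
    (by rwa [Finset.card_univ])
  rw [Finset.card_univ] at h
  rw [← h, Finset.card_filter]
  push_cast
  rw [← Finset.sum_subtype (Finset.univ.powersetCard k) (p := fun S : Finset α => S.card = k)
    (by simp) (fun T => if A ⊆ T then (1 : ℝ) else 0)]

/-- The matrix counting, for `k`-sets `S` and `T`, the `j`-sets contained in `T` and disjoint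
from `S`. -/
def disjMatrix (α : Type*) [DecidableEq α] (k j : ℕ) :
    Matrix {S : Finset α // S.card = k} {S : Finset α // S.card = k} ℝ :=
  fun S T => ((T.1 \ S.1).card.choose j : ℝ)

lemma choose_card_union_eq_sum {α : Type*} [DecidableEq α] {n p j : ℕ} {E J : Finset α}
    (hJ : J.card = j) (hE : E.card ≤ p) (hn : j + E.card ≤ n) :
    ((n - (J ∪ E).card).choose p : ℝ) =
      ∑ I ∈ E.powerset, if I ⊆ J then ((n - j - E.card).choose (p - I.card) : ℝ) else 0 := by
  rw [← Finset.sum_filter, show E.powerset.filter (· ⊆ J) = (E ∩ J).powerset by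
    ext I; simp only [Finset.mem_filter, Finset.mem_powerset, Finset.subset_inter_iff],
    Finset.sum_powerset_apply_card (fun i => ((n - j - E.card).choose (p - i) : ℝ))]
  have h1 := Finset.card_union_add_card_inter J E
  rw [Finset.inter_comm] at h1
  have h2 : (E ∩ J).card ≤ E.card := Finset.card_le_card Finset.inter_subset_left
  rw [show n - (J ∪ E).card = (E ∩ J).card + (n - j - E.card) by omega, Nat.add_choose_eq,
    Finset.Nat.sum_antidiagonal_eq_sum_range_succ_mk]
  push_cast
  symm
  simp only [nsmul_eq_mul]
  refine Finset.sum_subset (Finset.range_subset_range.2 (by omega)) fun i _ hi => ?_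
  rw [Nat.choose_eq_zero_of_lt (show (E ∩ J).card < i by simpa using hi)]
  simp

lemma disjMatrix_mulVec_inclVec {α : Type*} [DecidableEq α] [Fintype α] {k j : ℕ}
    (hk : 2 * k ≤ Fintype.card α) (hj : j ≤ k) {E : Finset α} (hE : E.card ≤ k) :
    (disjMatrix α k j).mulVec (inclVec k E) =
      ∑ I ∈ E.powerset, (((Fintype.card α - j - E.card).choose (Fintype.card α - k - I.card) : ℝ) *
        (Fintype.card α - k - I.card).choose (Fintype.card α - k - j)) • avoidVec k I := by
  set n := Fintype.card α with hn
  ext S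
  have hSc : (S.1ᶜ).card = n - k := by rw [Finset.card_compl, S.2]
  calc ((disjMatrix α k j).mulVec (inclVec k E)) S
      = ∑ T : {S : Finset α // S.card = k}, ∑ J ∈ S.1ᶜ.powersetCard j,
          if J ∪ E ⊆ T.1 then (1 : ℝ) else 0 := by
        refine Finset.sum_congr rfl fun T _ => ?_
        change ((T.1 \ S.1).card.choose j : ℝ) * (if E ⊆ T.1 then (1 : ℝ) else 0) = _
        rw [← Finset.card_powersetCard]
        have h : (T.1 \ S.1).powersetCard j = (S.1ᶜ.powersetCard j).filter (· ⊆ T.1) := by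
          ext J
          simp only [Finset.mem_powersetCard, Finset.mem_filter, Finset.subset_sdiff,
            Finset.subset_compl_iff_disjoint_right]
          tauto
        rw [h, Finset.card_filter]
        push_cast
        rw [Finset.sum_mul]
        refine Finset.sum_congr rfl fun J _ => ?_
        by_cases h1 : J ⊆ T.1 <;> by_cases h2 : E ⊆ T.1 <;> simp [Finset.union_subset_iff, h1, h2]
    _ = ∑ J ∈ S.1ᶜ.powersetCard j, ∑ I ∈ E.powerset,
          if I ⊆ J then ((n - j - E.card).choose (n - k - I.card) : ℝ) else 0 := by
        rw [Finset.sum_comm]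
        refine Finset.sum_congr rfl fun J hJ => ?_
        rw [sum_superset_indicator (by omega), ← hn]
        exact choose_card_union_eq_sum (Finset.mem_powersetCard.1 hJ).2 (by omega) (by omega)
    _ = _ := by
        rw [Finset.sum_comm, Finset.sum_apply]
        refine Finset.sum_congr rfl fun I _ => ?_
        rw [Pi.smul_apply, smul_eq_mul, ← Finset.sum_filter, Finset.sum_const, nsmul_eq_mul,
          avoidVec]
        split_ifs with hI
        · rw [card_filter_superset_powersetCard
            (by rwa [Finset.subset_compl_iff_disjoint_right]) (by omega), hSc]
          ring
        · have : (S.1ᶜ.powersetCard j).filter (I ⊆ ·) = ∅ := by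
            refine Finset.filter_eq_empty_iff.2 fun J hJ hIJ => hI ?_
            rw [← Finset.subset_compl_iff_disjoint_right]
            exact hIJ.trans (Finset.mem_powersetCard.1 hJ).1
          rw [this]
          simp

/-- Only the summand `I = E` of `disjMatrix_mulVec_inclVec` survives modulo lower degree. -/
lemma disjMatrix_mulVec_sub_mem_layer {α : Type*} [DecidableEq α] [Fintype α] {k j : ℕ}
    (hk : 2 * k ≤ Fintype.card α) (hj : j ≤ k) {E : Finset α} (hE : E.card ≤ k) :
    (disjMatrix α k j).mulVec (inclVec k E) - ((-1 : ℝ) ^ E.card *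
      (Fintype.card α - j - E.card).choose (Fintype.card α - k - E.card) *
        (Fintype.card α - k - E.card).choose (Fintype.card α - k - j)) • inclVec k E ∈
      layer α k E.card := by
  rw [disjMatrix_mulVec_inclVec hk hj hE, ← Finset.sum_erase_add _ _ (Finset.mem_powerset_self E),
    mul_assoc, mul_comm ((-1 : ℝ) ^ E.card), mul_smul _ ((-1 : ℝ) ^ E.card), add_sub_assoc,
    ← smul_sub]
  refine Submodule.add_mem _ (Submodule.sum_mem _ fun I hI => Submodule.smul_mem _ _
    (avoidVec_mem_layer ?_)) (Submodule.smul_mem _ _ (avoidVec_sub_mem_layer E))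
  rw [Finset.mem_erase, Finset.mem_powerset] at hI
  exact Finset.card_lt_card (hI.2.ssubset_of_ne hI.1)

/-! ### Wilson's matrix is positive semidefinite -/

/-- Wilson's matrix on the `(t + q)`-subsets of a set with `m + (t + q)` elements. It vanishes on
pairs meeting in at least `t` points. -/
noncomputable def wilsonMatrix (α : Type*) [DecidableEq α] (m t q : ℕ) :
    Matrix {S : Finset α // S.card = t + q} {S : Finset α // S.card = t + q} ℝ :=
  ∑ i ∈ Finset.range t, wilsonCoeff m t q i • disjMatrix α (t + q) (t + q - i)

/-- The matrix `I + Ω - J / N`, with `Ω` Wilson's matrix, `J` the all-ones matrix and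
`N = (m + q).choose q` the size of the family of all `(t + q)`-sets through `t` fixed points. -/
noncomputable def ratioMatrix (α : Type*) [DecidableEq α] (m t q : ℕ) :
    Matrix {S : Finset α // S.card = t + q} {S : Finset α // S.card = t + q} ℝ :=
  1 + wilsonMatrix α m t q - ((m + q).choose q : ℝ)⁻¹ • Matrix.of fun _ _ => 1

section Wilson

variable {α : Type*} [DecidableEq α]

lemma disjMatrix_isHermitian (k j : ℕ) : (disjMatrix α k j).IsHermitian := by
  ext S T
  change ((S.1 \ T.1).card.choose j : ℝ) = ((T.1 \ S.1).card.choose j : ℝ)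
  have h1 := Finset.card_sdiff_add_card_inter S.1 T.1
  have h2 := Finset.card_sdiff_add_card_inter T.1 S.1
  rw [Finset.inter_comm, T.2] at h2
  rw [S.2] at h1
  rw [show (S.1 \ T.1).card = (T.1 \ S.1).card by omega]

lemma ratioMatrix_isHermitian (m t q : ℕ) : (ratioMatrix α m t q).IsHermitian := by
  refine (Matrix.isHermitian_one.add ?_).sub ?_
  · unfold Matrix.IsHermitian wilsonMatrix
    rw [Matrix.conjTranspose_sum]
    refine Finset.sum_congr rfl fun i _ => ?_
    rw [Matrix.conjTranspose_smul, (disjMatrix_isHermitian _ _).eq]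
    simp
  · ext S T
    simp

lemma disjMatrix_eigenvalue_eq {m k i e : ℕ} (hm : k ≤ m) (hi : i ≤ k) (he : e ≤ k) :
    ((m + k - (k - i) - e).choose (m + k - k - e) : ℝ) *
        (m + k - k - e).choose (m + k - k - (k - i)) =
      (m + i - e).choose (k - e) * (k - e).choose i := by
  rw [show m + k - (k - i) - e = m + i - e by omega, show m + k - k - e = m - e by omega,
    show m + k - k - (k - i) = m - (k - i) by omega]
  norm_cast
  rcases le_or_gt i (k - e) with h | h
  · rw [Nat.choose_mul h, ← Nat.choose_symm_of_eq_add (show m + i - e = i + (m - e) by omega),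
      ← Nat.choose_symm_of_eq_add (show m - e = (k - e - i) + (m - (k - i)) by omega),
      show m + i - e - i = m - e by omega]
  · rw [Nat.choose_eq_zero_of_lt (show m - e < m - (k - i) by omega), Nat.choose_eq_zero_of_lt h]
    simp

variable [Fintype α]

lemma wilsonMatrix_mulVec_sub_mem_layer {m t q : ℕ} (hα : Fintype.card α = m + (t + q))
    (hm : t + q ≤ m) {E : Finset α} (hE : E.card ≤ t + q) :
    (wilsonMatrix α m t q).mulVec (inclVec (t + q) E) -
      wilsonEigenvalue m t q E.card • inclVec (t + q) E ∈ layer α (t + q) E.card := by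
  rw [wilsonMatrix, Matrix.sum_mulVec, wilsonEigenvalue, Finset.sum_smul, ← Finset.sum_sub_distrib]
  refine Submodule.sum_mem _ fun i hi => ?_
  have hi' := Finset.mem_range.1 hi
  rw [Matrix.smul_mulVec, mul_smul, ← smul_sub]
  refine Submodule.smul_mem _ _ ?_
  have h := disjMatrix_mulVec_sub_mem_layer (k := t + q) (j := t + q - i) (by omega) (by omega) hE
  rwa [hα, mul_assoc, disjMatrix_eigenvalue_eq hm (by omega) hE, ← mul_assoc] at h

lemma ones_mulVec_inclVec {k : ℕ} (hk : k ≤ Fintype.card α) (E : Finset α) :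
    (Matrix.of fun _ _ => (1 : ℝ)).mulVec (inclVec k E) =
      ((Fintype.card α - E.card).choose (Fintype.card α - k) : ℝ) • inclVec k (∅ : Finset α) := by
  ext S
  rw [← sum_superset_indicator hk]
  simp [Matrix.mulVec, dotProduct, inclVec]

/-- The all-ones matrix contributes only to the layer of constants. -/
lemma ratioMatrix_mulVec_sub_mem_layer {m t q : ℕ} (hα : Fintype.card α = m + (t + q))
    (hm : t + q ≤ m) {E : Finset α} (hE : E.card ≤ t + q) :
    (ratioMatrix α m t q).mulVec (inclVec (t + q) E) -
      (1 + wilsonEigenvalue m t q E.card - if E.card = 0 then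
        ((m + (t + q)).choose (t + q) / (m + q).choose q : ℝ) else 0) • inclVec (t + q) E ∈
      layer α (t + q) E.card := by
  have h := wilsonMatrix_mulVec_sub_mem_layer hα hm hE
  rw [ratioMatrix, Matrix.sub_mulVec, Matrix.add_mulVec, Matrix.one_mulVec, Matrix.smul_mulVec,
    ones_mulVec_inclVec (by omega)]
  split_ifs with h0
  · obtain rfl := Finset.card_eq_zero.1 h0
    convert h using 1
    rw [hα, Finset.card_empty, Nat.sub_zero, Nat.add_sub_cancel,
      Nat.choose_symm_of_eq_add (show m + (t + q) = m + (t + q) from rfl)]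
    module
  · have h1 : inclVec (t + q) (∅ : Finset α) ∈ layer α (t + q) E.card :=
      inclVec_mem_layer (by rw [Finset.card_empty]; omega)
    have := Submodule.sub_mem _ h (Submodule.smul_mem _ ((m + q).choose q : ℝ)⁻¹
      (Submodule.smul_mem _
        ((Fintype.card α - E.card).choose (Fintype.card α - (t + q)) : ℝ) h1))
    convert this using 1
    module

lemma ratioMatrix_posSemidef {m t q : ℕ} (hα : Fintype.card α = m + (t + q)) (ht : 2 ≤ t)
    (hq : 1 ≤ q) (hm : t * q + 1 ≤ m) : (ratioMatrix α m t q).PosSemidef := by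
  have hmt : t + q ≤ m := by nlinarith
  have hH := ratioMatrix_isHermitian (α := α) m t q
  rw [hH.posSemidef_iff_eigenvalues_nonneg]
  intro s
  obtain ⟨e, he, hs⟩ := eigenvalue_of_triangular (Matrix.mulVecLin (ratioMatrix α m t q))
    (fun e => 1 + wilsonEigenvalue m t q e - if e = 0 then
        ((m + (t + q)).choose (t + q) / (m + q).choose q : ℝ) else 0)
    (fun E hE => ratioMatrix_mulVec_sub_mem_layer hα hmt hE)
    (v := (hH.eigenvectorBasis s).ofLp) (c := hH.eigenvalues s)
    (fun h => hH.eigenvectorBasis.toBasis.ne_zero s (by simpa using h))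
    (hH.mulVec_eigenvectorBasis s)
  rw [hs]
  dsimp only
  split_ifs with h0
  · rw [h0, wilsonEigenvalue_zero m t q hmt]
    have h := choose_div_choose_eq (m + (t + q)) t q (by omega)
    rw [show m + (t + q) - t = m + q by omega] at h
    rw [h]
    simp
  · have := neg_one_le_wilsonEigenvalue m t q e ht hq hm (by omega) he
    simp only [Pi.zero_apply]
    linarith

end Wilson

/-! ### The bound for families of sets -/

/-- The entry of Wilson's matrix at a pair of sets meeting in `x` points. -/
lemma wilsonMatrix_apply {α : Type*} [DecidableEq α] {m t q : ℕ}
    (S T : {S : Finset α // S.card = t + q}) :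
    wilsonMatrix α m t q S T = ∑ i ∈ Finset.range t,
      wilsonCoeff m t q i * ((t + q - (S.1 ∩ T.1).card).choose (t + q - i) : ℝ) := by
  rw [wilsonMatrix, Matrix.sum_apply]
  refine Finset.sum_congr rfl fun i _ => ?_
  change wilsonCoeff m t q i * ((T.1 \ S.1).card.choose (t + q - i) : ℝ) = _
  rw [Finset.card_sdiff, T.2]

lemma wilsonMatrix_apply_of_le {α : Type*} [DecidableEq α] {m t q : ℕ}
    {S T : {S : Finset α // S.card = t + q}} (h : t ≤ (S.1 ∩ T.1).card) :
    wilsonMatrix α m t q S T = 0 := by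
  rw [wilsonMatrix_apply]
  refine Finset.sum_eq_zero fun i hi => ?_
  have := Finset.mem_range.1 hi
  rw [Nat.choose_eq_zero_of_lt (by omega)]
  simp

/-- Only two summands of the entry survive; the bound `m ≤ (q + 1) ^ 2` says exactly that the
negative one dominates. -/
lemma wilsonMatrix_apply_nonpos {α : Type*} [DecidableEq α] {m t q : ℕ}
    (hm : t + q + 2 ≤ m) (hm' : m ≤ (q + 1) ^ 2)
    {S T : {S : Finset α // S.card = t + 2 + q}} (h : (S.1 ∩ T.1).card = t) :
    wilsonMatrix α m (t + 2) q S T ≤ 0 := by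
  rw [wilsonMatrix_apply, Finset.sum_range_succ, Finset.sum_range_succ, Finset.sum_eq_zero, h]
  · obtain ⟨x, rfl⟩ : ∃ x, m = t + q + 2 + x := ⟨m - (t + q + 2), by omega⟩
    simp only [wilsonCoeff]
    rw [show t + 2 + q - 1 - t = q + 1 by omega, show t + 2 + q - 1 - (t + 1) = q by omega,
      show t + 2 + q - t = q + 2 by omega, show t + 2 + q - (t + 1) = q + 1 by omega,
      show t + q + 2 + x - (t + 2) + t = x + t + q by omega,
      show t + q + 2 + x - (t + 2) + (t + 1) = x + t + q + 1 by omega,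
      Odd.neg_one_pow ⟨t + 1, by ring⟩, Even.neg_one_pow ⟨t + 2, by ring⟩]
    have h1 := congrArg (Nat.cast : ℕ → ℝ) (Nat.choose_mul_succ_eq (x + t + q) q)
    rw [show x + t + q + 1 - q = x + t + 1 by omega] at h1
    have p1 : (0 : ℝ) < ((x + t + q).choose q : ℝ) := by
      exact_mod_cast Nat.choose_pos (by omega)
    have p2 : (0 : ℝ) < ((x + t + q + 1).choose q : ℝ) := by
      exact_mod_cast Nat.choose_pos (by omega)
    have hm2 : ((t : ℝ) + q + 2 + x) ≤ (q + 1) ^ 2 := by exact_mod_cast hm'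
    have hs : ∀ r : ℕ, ((r + 1).choose r : ℝ) = r + 1 := fun r => by
      rw [Nat.choose_succ_self_right]; push_cast; ring
    rw [Nat.choose_self, Nat.choose_self, hs, show q + 2 = q + 1 + 1 from rfl, hs]
    push_cast at h1 ⊢
    rw [zero_add, div_mul_eq_mul_div, div_mul_eq_mul_div, div_add_div _ _ p1.ne' p2.ne',
      div_nonpos_iff]
    right
    refine ⟨?_, by positivity⟩
    have hy : (0 : ℝ) < x + t + 1 := by positivity
    have h2 : ((q : ℝ) + 2) * (x + t + 1) ≤ (q + 1) * (x + t + q + 1) := by nlinarith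
    have h3 := mul_le_mul_of_nonneg_left h2 p1.le
    refine nonpos_of_mul_nonpos_right (b := _) (a := (x : ℝ) + t + 1) ?_ hy
    nlinarith
  · intro i hi
    have := Finset.mem_range.1 hi
    rw [h, Nat.choose_eq_zero_of_lt (show t + 2 + q - t < t + 2 + q - i by omega)]
    simp

/-- The ratio bound: evaluate the quadratic form of `ratioMatrix` at the indicator of the family. -/
lemma card_le_of_ratioMatrix_posSemidef {α : Type*} [DecidableEq α] [Fintype α] {m t q : ℕ}
    (hpsd : (ratioMatrix α m t q).PosSemidef)
    (F : Finset {S : Finset α // S.card = t + q})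
    (hF : ∀ S ∈ F, ∀ T ∈ F, S ≠ T → wilsonMatrix α m t q S T ≤ 0) :
    F.card ≤ (m + q).choose q := by
  set N := (m + q).choose q with hN
  have hNpos : (0 : ℝ) < N := by exact_mod_cast Nat.choose_pos (by omega)
  have h := hpsd.dotProduct_mulVec_nonneg (fun S => if S ∈ F then 1 else 0)
  have h1 : 0 ≤ ∑ S ∈ F, ∑ T ∈ F, ratioMatrix α m t q S T := by
    simpa [dotProduct, Matrix.mulVec, Finset.sum_ite_mem] using h
  have h2 : ∑ S ∈ F, ∑ T ∈ F, ratioMatrix α m t q S T ≤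
      ∑ S ∈ F, ∑ T ∈ F, ((if S = T then (1 : ℝ) else 0) - (N : ℝ)⁻¹) := by
    refine Finset.sum_le_sum fun S hS => Finset.sum_le_sum fun T hT => ?_
    have he : ratioMatrix α m t q S T =
        (if S = T then (1 : ℝ) else 0) + wilsonMatrix α m t q S T - (N : ℝ)⁻¹ := by
      simp [ratioMatrix, Matrix.one_apply, hN]
    rw [he]
    by_cases hST : S = T
    · subst hST
      rw [wilsonMatrix_apply_of_le (by rw [Finset.inter_self, S.2]; omega)]
      simp
    · linarith [hF S hS T hT hST]
  have h3 : ∑ S ∈ F, ∑ T ∈ F, ((if S = T then (1 : ℝ) else 0) - (N : ℝ)⁻¹) =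
      F.card * (1 - F.card * (N : ℝ)⁻¹) := by
    simp [Finset.sum_sub_distrib]
    ring
  have h4 := h1.trans (h2.trans_eq h3)
  by_contra! hlt
  have hlt' : (N : ℝ) < F.card := by exact_mod_cast hlt
  have h5 : 1 < F.card * (N : ℝ)⁻¹ := by rwa [← div_eq_mul_inv, one_lt_div hNpos]
  have h6 : (0 : ℝ) < F.card := hNpos.trans hlt'
  nlinarith

/-- Two distinct pairs in a set with three elements meet in exactly one point. -/
lemma card_inter_eq_one_of_pairs {α : Type*} [DecidableEq α] [Fintype α]
    (hα : Fintype.card α = 3) {A B : Finset α} (hA : A.card = 2) (hB : B.card = 2) (hAB : A ≠ B) :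
    (A ∩ B).card = 1 := by
  have h1 := Finset.card_union_add_card_inter A B
  have h2 : (A ∪ B).card ≤ 3 := hα ▸ Finset.card_le_univ _
  have h3 : (A ∩ B).card < 2 := by
    refine lt_of_le_of_ne (hA ▸ Finset.card_le_card Finset.inter_subset_left) fun h => hAB ?_
    rw [← Finset.eq_of_subset_of_card_le Finset.inter_subset_left
      (by omega : A.card ≤ (A ∩ B).card)]
    exact Finset.eq_of_subset_of_card_le Finset.inter_subset_right (by omega)
  omega

theorem mainTheorem5 (n k t : ℕ) (ht : 2 ≤ t) (htk : (t : ℚ) ≤ (k : ℚ) / 2 + 1)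
    (hn_lower : ((t : ℤ) + 1) * ((k : ℤ) - t + 1) ≤ (n : ℤ))
    (hn_upper : (n : ℤ) ≤ (k : ℤ) ^ 2 + (k : ℤ) * (3 - 2 * (t : ℤ)) + ((t : ℤ) - 1) ^ 2)
    (F : Finset (Finset (Fin n)))
    (hF : IsLSystem n k ({t - 2} ∪ Set.Icc t (k - 1)) F) :
    F.card ≤ Nat.choose (n - t) (k - t) := by
  have htk' : 2 * t ≤ k + 2 := by
    have : (2 * t : ℚ) ≤ k + 2 := by linarith
    exact_mod_cast this
  obtain ⟨q, rfl⟩ : ∃ q, k = t + q := ⟨k - t, by omega⟩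
  have hlow : t * q + 1 + (t + q) ≤ n := by
    push_cast at hn_lower
    zify
    linarith
  obtain ⟨m, rfl⟩ : ∃ m, n = m + (t + q) := ⟨n - (t + q), by omega⟩
  have hm : t * q + 1 ≤ m := by omega
  have hm' : m ≤ (q + 1) ^ 2 := by
    push_cast at hn_upper
    zify
    linarith
  rw [Nat.add_sub_cancel_left, show m + (t + q) - t = m + q by omega]
  rcases Nat.eq_zero_or_pos q with rfl | hq
  · -- Here `t = k = 2` and `n = 3`, below the range `n ≥ 2 * k` of the matrix argument.
    obtain rfl : t = 2 := by omega
    obtain rfl : m = 1 := by omega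
    rw [Nat.choose_zero_right, Finset.card_le_one]
    intro A hA B hB
    by_contra hAB
    have h1 := hF.2 A hA B hB hAB
    rw [card_inter_eq_one_of_pairs (by simp) (hF.1 A hA) (hF.1 B hB) hAB] at h1
    simp at h1
  have hmt : t + q ≤ m := by nlinarith
  have hpsd := ratioMatrix_posSemidef (α := Fin (m + (t + q))) (by simp) ht hq hm
  have h := card_le_of_ratioMatrix_posSemidef hpsd
    (F.subtype fun S => S.card = t + q) ?_
  · rwa [Finset.card_subtype, Finset.filter_true_of_mem hF.1] at h
  · intro S hS T hT hST
    rw [Finset.mem_subtype] at hS hT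
    rcases hF.2 S.1 hS T.1 hT (fun h => hST (Subtype.ext h)) with h | h
    · obtain ⟨r, rfl⟩ : ∃ r, t = r + 2 := ⟨t - 2, by omega⟩
      exact wilsonMatrix_apply_nonpos (by omega) hm' h
    · exact (wilsonMatrix_apply_of_le h.1).le
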